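/- Let $\mu_4$ be the Jorgensen–Pedersen measure, i.e. the unique Borel probability measure on $\mathbb{R}$ with $\mu_4(E)=\frac12\big(\mu_4(\tau_0^{-1}(E))+\mu_4(\tau_2^{-1}(E))\big)$ for all Borel sets $E$, where $\tau_b(x)=\frac{x+b}{4}$ (so $R=4$, $B=\{0,2\}$). Write $e_\lambda(x)=e^{2\pi i\lambda x}$. For a set of integers $D$, a cycle for $D$ is a set $\{t_0,\dots,t_{p-1}\}\subset\mathbb{R}$, $p\ge 1$, for which there are $d_0,\dots,d_{p-1}\in D$ with $\frac{t_i-d_i}{4}=t_{i+1}$ for $0\le i<p$, where $t_p:=t_0$; it is extreme if $\left|\frac{1+e^{2\pi i\cdot 2t_j}}{2}\right|=1$ for all $0\le j<p$. Let $L$ be a finite set of integers that contains $0$ and whose other elements are odd. Assume that one of the following conditions is satisfied: (i) there exist $l_0,l_0'\in L$ with $l_0\equiv 1\pmod 4$ and $l_0'\equiv 3\pmod 4$; (ii) there exists $l_0\in L$, $l_0\neq 0$, such that there is no extreme cycle for $\{0,l_0\}$ other than the trivial one $\{0\}$. Let $(\alpha_l)_{l\in L}$ be nonzero complex numbers with $\alpha_0=1$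 and $\sum_{l\in L}|\alpha_l|^2=2$. Let $\Omega(L)$ be the set consisting of the empty word and of all finite words $l_0l_1\dots l_k$ ($k\ge 0$) with letters in $L$ and $l_k\ne 0$. Then the family $$\left(\Big(\prod_{j=0}^k\alpha_{l_j}\Big)\,e_{l_0+4l_1+\dots+4^kl_k}\right)_{l_0\dots l_k\in\Omega(L)},$$ indexed by words (the empty word giving the constant function $1$), is a Parseval frame for $L^2(\mu_4)$: for every $v\in L^2(\mu_4)$, the sum over all words in $\Omega(L)$ of the squared moduli of the inner products of $v$ with the members of the family equals $\|v\|^2$. -/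

import Mathlib

open MeasureTheory ProbabilityTheory
open scoped ENNReal

noncomputable section

/-! ### One-dimensional self-affine measures with equal weights -/

/-- The point `∑_{k ≥ 1} R^{-k} b_k` of the attractor, for a sequence of digits in `B`
(the sequence is indexed from `0`). -/
def attractorPoint (R : ℤ) (B : Finset ℤ) (ω : ℕ → B) : ℝ :=
  ∑' k : ℕ, ((ω k : ℤ) : ℝ) / (R : ℝ) ^ (k + 1)

/-- The self-affine measure `μ(R, B)` with equal weights on `ℝ`: the law of `∑_{k ≥ 1} R^{-k} b_k`,
where the digits `b_k` are independent and uniformly distributed in `B`. For `|R| ≥ 2` and `B`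
nonempty it is the unique probability measure with
`μ(E) = |B|⁻¹ ∑_{b ∈ B} μ(τ_b⁻¹ E)`, `τ_b(x) = R⁻¹ (x + b)`;
see `selfAffineMeasure_apply` and `eq_selfAffineMeasure`. -/
def selfAffineMeasure (R : ℤ) (B : Finset ℤ) : Measure ℝ :=
  (Measure.infinitePi fun _ : ℕ => uniformOn (Set.univ : Set B)).map (attractorPoint R B)

instance isFiniteMeasure_selfAffineMeasure (R : ℤ) (B : Finset ℤ) :
    IsFiniteMeasure (selfAffineMeasure R B) := by
  unfold selfAffineMeasure
  rcases isEmpty_or_nonempty B with h | h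
  · have : IsEmpty (ℕ → B) := ⟨fun ω => h.false (ω 0)⟩
    rw [Measure.eq_zero_of_isEmpty (Measure.infinitePi _), Measure.map_zero]
    infer_instance
  · infer_instance

lemma attractorPoint_bound (R : ℤ) (B : Finset ℤ) (hR : 2 ≤ |R|) :
    ∃ u : ℕ → ℝ, Summable u ∧
      ∀ k (ω : ℕ → B), ‖((ω k : ℤ) : ℝ) / (R : ℝ) ^ (k + 1)‖ ≤ u k := by
  have hR' : (2 : ℝ) ≤ |(R : ℝ)| := by exact_mod_cast hR
  refine ⟨fun k => (∑ b ∈ B, |(b : ℝ)|) * (1 / 2) ^ k, ?_, fun k ω => ?_⟩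
  · exact (summable_geometric_of_lt_one (by norm_num) (by norm_num)).mul_left _
  · rw [norm_div, norm_pow, Real.norm_eq_abs, Real.norm_eq_abs, div_eq_mul_inv]
    have h1 : |((ω k : ℤ) : ℝ)| ≤ ∑ b ∈ B, |(b : ℝ)| :=
      Finset.single_le_sum (f := fun b : ℤ => |(b : ℝ)|) (fun _ _ => abs_nonneg _) (ω k).2
    have h2 : (|(R : ℝ)| ^ (k + 1))⁻¹ ≤ (1 / 2) ^ k := by
      rw [one_div, inv_pow]
      apply inv_anti₀ (by positivity)
      calc (2 : ℝ) ^ k ≤ 2 ^ (k + 1) := pow_le_pow_right₀ (by norm_num) (by omega)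
        _ ≤ _ := by gcongr
    exact mul_le_mul h1 h2 (by positivity) (Finset.sum_nonneg fun _ _ => abs_nonneg _)

lemma measurable_attractorPoint (R : ℤ) (B : Finset ℤ) (hR : 2 ≤ |R|) :
    Measurable (attractorPoint R B) := by
  obtain ⟨u, hu, hb⟩ := attractorPoint_bound R B hR
  refine Continuous.measurable (continuous_tsum (fun k => ?_) hu hb)
  have : Continuous fun b : B => ((b : ℤ) : ℝ) := continuous_of_discreteTopology
  exact (this.comp (continuous_apply k)).div_const _

lemma attractorPoint_cons (R : ℤ) (B : Finset ℤ) (hR : 2 ≤ |R|) (b : B) (ω : ℕ → B) :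
    attractorPoint R B (fun n => Nat.casesOn n b ω)
      = (attractorPoint R B ω + ((b : ℤ) : ℝ)) / (R : ℝ) := by
  obtain ⟨u, hu, hb⟩ := attractorPoint_bound R B hR
  have hR0 : (R : ℝ) ≠ 0 := by
    intro h
    have : R = 0 := by exact_mod_cast h
    simp [this] at hR
  have hs := Summable.of_norm_bounded hu fun k => hb k (fun n => Nat.casesOn n b ω)
  unfold attractorPoint
  rw [hs.tsum_eq_zero_add, add_div, add_comm, ← tsum_div_const]
  congr 1
  · refine tsum_congr fun k => ?_
    change ((ω k : ℤ) : ℝ) / (R : ℝ) ^ (k + 1 + 1) = _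
    rw [pow_succ _ (k + 1), div_div]
  · simp

lemma uniformOn_univ_eq_sum (B : Finset ℤ) [Nonempty B] (s : Set B) :
    uniformOn (Set.univ : Set B) s = (B.card : ℝ≥0∞)⁻¹ * ∑ b : B, s.indicator 1 b := by
  classical
  rw [uniformOn_univ, Fintype.card_coe, ENNReal.div_eq_inv_mul]
  congr 1
  have h : Measure.count s = ∑' b : B, s.indicator (fun _ => (1 : ℝ≥0∞)) b := by
    rw [← tsum_subtype, Measure.count_apply (Set.toFinite s).measurableSet]
    exact ENNReal.tsum_set_one s |>.symm
  rw [h, tsum_fintype]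
  rfl

lemma infinitePi_uniformOn_eq_sum (B : Finset ℤ) [Nonempty B] :
    (Measure.infinitePi fun _ : ℕ => uniformOn (Set.univ : Set B)) =
      (B.card : ℝ≥0∞)⁻¹ • ∑ b : B,
        (Measure.infinitePi fun _ : ℕ => uniformOn (Set.univ : Set B)).map
          (fun ω n => Nat.casesOn (motive := fun _ => B) n b ω) := by
  classical
  have hm : ∀ b : B, Measurable
      (fun (ω : ℕ → B) (n : ℕ) => Nat.casesOn (motive := fun _ => B) n b ω) := by
    intro b
    refine measurable_pi_lambda _ fun n => ?_
    cases n with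
    | zero => exact measurable_const
    | succ n => exact measurable_pi_apply n
  symm
  refine Measure.eq_infinitePi _ fun s t ht => ?_
  obtain ⟨n, hn⟩ : ∃ n, s ⊆ Finset.range (n + 1) :=
    ⟨s.sup id, fun i hi => Finset.mem_range.2 (Nat.lt_succ_of_le (Finset.le_sup (f := id) hi))⟩
  let t' : ℕ → Set B := fun i => if i ∈ s then t i else Set.univ
  have ht' : ∀ i, MeasurableSet (t' i) := fun i => (Set.toFinite _).measurableSet
  have hset : Set.pi (s : Set ℕ) t = Set.pi (Finset.range (n + 1) : Set ℕ) t' := by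
    ext ω
    simp only [Set.mem_pi, t', Finset.mem_coe]
    constructor
    · intro h i _
      split_ifs with his
      · exact h i his
      · trivial
    · intro h i hi
      simpa [hi] using h i (hn hi)
  have hprod : ∏ i ∈ s, uniformOn (Set.univ : Set B) (t i)
      = ∏ i ∈ Finset.range (n + 1), uniformOn (Set.univ : Set B) (t' i) := by
    rw [← Finset.prod_subset hn]
    · exact Finset.prod_congr rfl fun i hi => by simp [t', hi]
    · intro i _ hi
      simp [t', hi]
  have hms : MeasurableSet (Set.pi (Finset.range (n + 1) : Set ℕ) t') :=
    MeasurableSet.pi (Finset.countable_toSet _) fun i _ => ht' i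
  rw [hset, hprod, Finset.prod_range_succ', mul_comm, uniformOn_univ_eq_sum B (t' 0), mul_assoc,
    Finset.sum_mul, Measure.smul_apply, Measure.finsetSum_apply, smul_eq_mul]
  congr 1
  refine Finset.sum_congr rfl fun b _ => ?_
  rw [Measure.map_apply (hm b) hms]
  by_cases hb : b ∈ t' 0
  · rw [Set.indicator_of_mem hb, Pi.one_apply, one_mul,
      ← Measure.infinitePi_pi (fun _ : ℕ => uniformOn (Set.univ : Set B))
        (s := Finset.range n) (t := fun i => t' (i + 1)) (fun i _ => ht' _)]
    congr 1
    ext ω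
    simp only [Set.mem_preimage, Set.mem_pi, Finset.coe_range, Set.mem_Iio]
    constructor
    · intro h i hi
      exact h (i + 1) (by omega)
    · intro h i hi
      cases i with
      | zero => exact hb
      | succ i => exact h i (by omega)
  · rw [Set.indicator_of_notMem hb, zero_mul]
    convert measure_empty (μ := Measure.infinitePi fun _ : ℕ => uniformOn (Set.univ : Set B))
    ext ω
    simp only [Set.mem_preimage, Set.mem_pi, Finset.coe_range, Set.mem_Iio,
      Set.mem_empty_iff_false, iff_false]
    intro h
    exact hb (h 0 (by omega))

theorem isProbabilityMeasure_selfAffineMeasure (R : ℤ) (B : Finset ℤ) [Nonempty B]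
    (hR : 2 ≤ |R|) : IsProbabilityMeasure (selfAffineMeasure R B) :=
  Measure.isProbabilityMeasure_map (measurable_attractorPoint R B hR).aemeasurable

/-- The defining invariance equation of the self-affine measure. -/
theorem selfAffineMeasure_apply (R : ℤ) (B : Finset ℤ) [Nonempty B] (hR : 2 ≤ |R|)
    {E : Set ℝ} (hE : MeasurableSet E) :
    selfAffineMeasure R B E = (B.card : ℝ≥0∞)⁻¹ *
      ∑ b ∈ B, selfAffineMeasure R B ((fun x : ℝ => (x + (b : ℝ)) / (R : ℝ)) ⁻¹' E) := by
  have hX := measurable_attractorPoint R B hR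
  have hm : ∀ b : B, Measurable
      (fun (ω : ℕ → B) (n : ℕ) => Nat.casesOn (motive := fun _ => B) n b ω) := by
    intro b
    refine measurable_pi_lambda _ fun n => ?_
    cases n with
    | zero => exact measurable_const
    | succ n => exact measurable_pi_apply n
  have hτ : ∀ b : ℤ, Measurable (fun x : ℝ => (x + (b : ℝ)) / (R : ℝ)) := fun b => by fun_prop
  conv_lhs => rw [selfAffineMeasure, Measure.map_apply hX hE, infinitePi_uniformOn_eq_sum,
    Measure.smul_apply, Measure.finsetSum_apply, smul_eq_mul]
  congr 1
  rw [← Finset.sum_coe_sort B]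
  refine Finset.sum_congr rfl fun b _ => ?_
  rw [Measure.map_apply (hm b) (hX hE), selfAffineMeasure, Measure.map_apply hX (hτ b hE)]
  congr 1
  ext ω
  simp only [Set.mem_preimage]
  rw [attractorPoint_cons R B hR b ω]

/-- The self-affine measure is the only probability measure with the invariance property. -/
theorem eq_selfAffineMeasure (R : ℤ) (B : Finset ℤ) [Nonempty B] (hR : 2 ≤ |R|)
    (ν : Measure ℝ) [IsProbabilityMeasure ν]
    (hν : ∀ E : Set ℝ, MeasurableSet E → ν E = (B.card : ℝ≥0∞)⁻¹ *
      ∑ b ∈ B, ν ((fun x : ℝ => (x + (b : ℝ)) / (R : ℝ)) ⁻¹' E)) :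
    ν = selfAffineMeasure R B := by
  have := isProbabilityMeasure_selfAffineMeasure R B hR
  have hcard : (B.card : ℝ) ≠ 0 := by
    have : B.card ≠ 0 := Finset.card_ne_zero.2 (Finset.nonempty_coe_sort.1 inferInstance)
    exact_mod_cast this
  have hR' : (2 : ℝ) ≤ |(R : ℝ)| := by exact_mod_cast hR
  have hτ : ∀ b : ℤ, Measurable (fun x : ℝ => (x + (b : ℝ)) / (R : ℝ)) := fun b => by fun_prop
  have key : ∀ ρ : Measure ℝ, IsProbabilityMeasure ρ →
      (∀ E : Set ℝ, MeasurableSet E → ρ E = (B.card : ℝ≥0∞)⁻¹ *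
        ∑ b ∈ B, ρ ((fun x : ℝ => (x + (b : ℝ)) / (R : ℝ)) ⁻¹' E)) →
      ∀ t : ℝ, charFun ρ t = (((B.card : ℝ)⁻¹ : ℝ) : ℂ) *
        ((∑ b ∈ B, Complex.exp ((t * b / R : ℝ) * Complex.I)) * charFun ρ (t / R)) := by
    intro ρ hρ h t
    have hsum : ρ = (B.card : ℝ≥0∞)⁻¹ •
        ∑ b ∈ B, ρ.map (fun x : ℝ => (x + (b : ℝ)) / (R : ℝ)) := by
      ext E hE
      rw [h E hE, Measure.smul_apply, Measure.finsetSum_apply, smul_eq_mul]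
      congr 1
      exact Finset.sum_congr rfl fun b _ => (Measure.map_apply (hτ b) hE).symm
    have hint : ∀ (σ : Measure ℝ) [IsFiniteMeasure σ],
        Integrable (fun x : ℝ => Complex.exp (t * x * Complex.I)) σ := by
      intro σ _
      refine Integrable.of_bound (C := 1) (Continuous.aestronglyMeasurable (by fun_prop))
        (Filter.Eventually.of_forall fun x => ?_)
      rw [← Complex.ofReal_mul, Complex.norm_exp_ofReal_mul_I]
    rw [charFun_apply_real, hsum, integral_smul_measure, integral_finsetSum_measure,
      ← hsum, charFun_apply_real, Finset.sum_mul, ENNReal.toReal_inv, ENNReal.toReal_natCast,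
      Complex.real_smul]
    · congr 1
      refine Finset.sum_congr rfl fun b _ => ?_
      rw [integral_map (hτ b).aemeasurable (Continuous.aestronglyMeasurable (by fun_prop)),
        ← integral_const_mul]
      refine integral_congr_ae (Filter.Eventually.of_forall fun x => ?_)
      change Complex.exp _ = Complex.exp _ * Complex.exp _
      rw [← Complex.exp_add]
      congr 1
      push_cast
      ring
    · intro b _
      exact hint _
  have h1 := key ν inferInstance hν
  have h2 := key (selfAffineMeasure R B) this fun E hE => selfAffineMeasure_apply R B hR hE
  apply Measure.ext_of_charFun
  have hle : ∀ t : ℝ, ‖charFun ν t - charFun (selfAffineMeasure R B) t‖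
      ≤ ‖charFun ν (t / R) - charFun (selfAffineMeasure R B) (t / R)‖ := by
    intro t
    rw [h1 t, h2 t, ← mul_sub, ← mul_sub, ← mul_assoc, norm_mul]
    refine mul_le_of_le_one_left (norm_nonneg _) ?_
    rw [norm_mul, Complex.norm_real, norm_inv, Real.norm_natCast]
    have : ‖∑ b ∈ B, Complex.exp ((t * b / R : ℝ) * Complex.I)‖ ≤ B.card := by
      refine (norm_sum_le _ _).trans ?_
      simp only [Complex.norm_exp_ofReal_mul_I, Finset.sum_const, nsmul_eq_mul, mul_one, le_refl]
    calc _ ≤ (B.card : ℝ)⁻¹ * B.card := by gcongr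
      _ = 1 := inv_mul_cancel₀ hcard
  funext t
  have hiter : ∀ n : ℕ, ‖charFun ν t - charFun (selfAffineMeasure R B) t‖
      ≤ ‖charFun ν (t * ((R : ℝ)⁻¹) ^ n)
        - charFun (selfAffineMeasure R B) (t * ((R : ℝ)⁻¹) ^ n)‖ := by
    intro n
    induction n with
    | zero => simp
    | succ n ih =>
      refine ih.trans ((hle _).trans_eq ?_)
      rw [pow_succ, ← mul_assoc, div_eq_mul_inv]
  have hlim : Filter.Tendsto (fun n : ℕ => t * ((R : ℝ)⁻¹) ^ n) Filter.atTop (nhds 0) := by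
    have : |(R : ℝ)⁻¹| < 1 := by
      rw [abs_inv]
      exact inv_lt_one_of_one_lt₀ (by linarith)
    simpa using (tendsto_pow_atTop_nhds_zero_of_abs_lt_one this).const_mul t
  have hcont : Continuous fun s : ℝ =>
      ‖charFun ν s - charFun (selfAffineMeasure R B) s‖ :=
    (continuous_charFun.sub continuous_charFun).norm
  have hl := (hcont.tendsto 0).comp hlim
  simp only [charFun_zero, probReal_univ, sub_self, norm_zero] at hl
  have h0 := ge_of_tendsto' hl hiter
  exact sub_eq_zero.1 (norm_le_zero_iff.1 h0)

/-! ### Exponentials and Parseval frames -/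

/-- The exponential function `e_λ(x) = exp(2πiλx)`. -/
def exponential (lam : ℝ) (x : ℝ) : ℂ :=
  Complex.exp (2 * Real.pi * Complex.I * lam * x)

lemma memLp_exponential (μ : Measure ℝ) [IsFiniteMeasure μ] (lam : ℝ) :
    MemLp (exponential lam) 2 μ := by
  refine MemLp.of_bound (C := 1) ?_ (Filter.Eventually.of_forall fun x => ?_)
  · exact Continuous.aestronglyMeasurable (by unfold exponential; fun_prop)
  · have : (2 * Real.pi * Complex.I * lam * x : ℂ)
        = ((2 * Real.pi * lam * x : ℝ) : ℂ) * Complex.I := by push_cast; ring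
    rw [exponential, this, Complex.norm_exp_ofReal_mul_I]

/-- The exponential `e_λ` as an element of `L²(μ)`. -/
def exponentialL2 (μ : Measure ℝ) [IsFiniteMeasure μ] (lam : ℝ) : Lp ℂ 2 μ :=
  (memLp_exponential μ lam).toLp (exponential lam)

/-- A family in a Hilbert space is a Parseval frame (a frame with both frame bounds `1`) if
`∑_i |⟨v, e_i⟩|² = ‖v‖²` for every vector `v`. -/
def IsParsevalFrame {ι H : Type*} [NormedAddCommGroup H] [InnerProductSpace ℂ H]
    (e : ι → H) : Prop :=
  ∀ v : H, HasSum (fun i => ‖inner ℂ v (e i)‖ ^ 2) (‖v‖ ^ 2)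

/-! ### Words, frequencies and weights -/

/-- `Ω(L)`: the empty word and all finite words with letters in `L` whose last letter
is not `0`. -/
def wordSet (L : Finset ℤ) : Set (List ℤ) :=
  {w | (∀ l ∈ w, l ∈ L) ∧ ∀ h : w ≠ [], w.getLast h ≠ 0}

/-- The integer `l_0 + R l_1 + ⋯ + R^k l_k` of the word `l_0 l_1 … l_k`
(it is `0` for the empty word). -/
def wordFrequency (R : ℤ) (w : List ℤ) : ℤ :=
  ∑ i : Fin w.length, R ^ (i : ℕ) * w.get i

/-- The weight `α_{l_0} α_{l_1} ⋯ α_{l_k}` of the word `l_0 l_1 … l_k`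
(it is `1` for the empty word). -/
def wordWeight (α : ℤ → ℂ) (w : List ℤ) : ℂ :=
  (w.map α).prod

/-! ### Extreme cycles -/

/-- `m_B(x) = |B|⁻¹ ∑_{b ∈ B} exp(2πibx)`. -/
def maskFunction (B : Finset ℤ) (x : ℝ) : ℂ :=
  (B.card : ℂ)⁻¹ * ∑ b ∈ B, Complex.exp (2 * Real.pi * Complex.I * b * x)

/-- `C = {t_0, …, t_{p-1}}`, `p ≥ 1`, is a cycle for `(R, L)`: there are `l_0, …, l_{p-1}` in `L`
with `(t_i - l_i) / R = t_{i+1}` for `i < p`, where `t_p = t_0`. -/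
def IsCycle (R : ℤ) (L : Finset ℤ) (C : Set ℝ) : Prop :=
  ∃ (p : ℕ) (t : ℕ → ℝ) (l : ℕ → ℤ), 0 < p ∧ (∀ i < p, l i ∈ L) ∧
    (∀ i < p, (t i - (l i : ℝ)) / (R : ℝ) = t (i + 1)) ∧ t p = t 0 ∧ C = t '' Set.Iio p

/-- A cycle for `(R, L)` is extreme for `(R, B, L)` if `|m_B| = 1` at each of its points. -/
def IsExtremeCycle (R : ℤ) (B L : Finset ℤ) (C : Set ℝ) : Prop :=
  IsCycle R L C ∧ ∀ t ∈ C, ‖maskFunction B t‖ = 1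

end

-- Let `S_l*` be the adjoint of `e_k ↦ e_{l+4k}`: it averages `e_{-l} f` over the two inverse
-- branches. These differ by `1/2`, and `e_{-l}(1/2)` is `1` for `l = 0` and `-1` for odd `l`. As
-- `α_0 = 1` and the odd letters carry total weight `1`, the parallelogram law gives `∑ |α_l|² ‖S_l*
-- f‖² = ‖f‖²` (`sum_integral_norm_branchAdjoint_sq`). The coefficient of `f` at `l + 4k` is that of
-- `S_l* f` at `k`, so removing first letters and inducting on word length yields the Bessel bound
-- (`sum_wordEnergy_le`), and the total energy satisfies `E(f) = ∑ |α_l|² E(S_l* f)`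
-- (`tsum_wordEnergy_eq_sum`).
--
-- Exponentials are total in `L²`, so equality is needed only for `h(t) = E(e_t)`. Since `S_l* e_t`
-- is a multiple of `e_{(t-l)/4}`, `h` is a continuous fixed point of a transfer operator whose
-- weights sum to `1`. Moreover `h ≤ 1`, and the empty word gives `h(0) = 1`. On an interval stable
-- under all maps `t ↦ (t-l)/4`, the minimizers of `h` form a compact set invariant under the
-- transitions of positive weight. Such a set contains `0` (`zero_mem_of_isCompact_of_invariant`): a
-- noninteger point is driven to `0` by the letter `0`, while a finite invariant set of integers
-- avoiding `0` is excluded by the congruences modulo 4 or by the absence of nontrivial extreme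
-- cycles. Hence `min h = h(0) = 1`.

local notation "μ₄" => selfAffineMeasure 4 {0, 2}

/-! ### The invariance equation of `μ₄` for functions -/

instance : IsProbabilityMeasure μ₄ :=
  have : Nonempty ({0, 2} : Finset ℤ) := ⟨⟨0, by simp⟩⟩
  isProbabilityMeasure_selfAffineMeasure 4 {0, 2} (by norm_num)

lemma selfAffineMeasure_four_eq_smul_add :
    μ₄ = (2 : ℝ≥0∞)⁻¹ •
      (Measure.map (fun x => x / 4) μ₄ + Measure.map (fun x => (x + 2) / 4) μ₄) := by
  have : Nonempty ({0, 2} : Finset ℤ) := ⟨⟨0, by simp⟩⟩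
  ext E hE
  rw [Measure.smul_apply, Measure.add_apply, Measure.map_apply (by fun_prop) hE,
    Measure.map_apply (by fun_prop) hE, selfAffineMeasure_apply 4 {0, 2} (by norm_num) hE,
    Finset.sum_pair (by norm_num), Finset.card_pair (by norm_num)]
  simp

/-- One summand of the invariance equation is dropped. The domination is what lets composition with
a branch preserve `L^p`. -/
lemma map_div_four_le : Measure.map (fun x => x / 4) μ₄ ≤ (2 : ℝ≥0∞) • μ₄ := by
  conv_rhs => rw [selfAffineMeasure_four_eq_smul_add, smul_smul,
    ENNReal.mul_inv_cancel two_ne_zero ENNReal.ofNat_ne_top, one_smul]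
  exact Measure.le_add_right le_rfl

lemma map_add_two_div_four_le : Measure.map (fun x => (x + 2) / 4) μ₄ ≤ (2 : ℝ≥0∞) • μ₄ := by
  conv_rhs => rw [selfAffineMeasure_four_eq_smul_add, smul_smul,
    ENNReal.mul_inv_cancel two_ne_zero ENNReal.ofNat_ne_top, one_smul]
  exact Measure.le_add_left le_rfl

lemma memLp_comp_div_four {E : Type*} [NormedAddCommGroup E] {f : ℝ → E} {p : ℝ≥0∞}
    (hf : MemLp f p μ₄) : MemLp (fun x => f (x / 4)) p μ₄ :=
  (hf.of_measure_le_smul ENNReal.ofNat_ne_top map_div_four_le).comp_of_map (by fun_prop)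

lemma memLp_comp_add_two_div_four {E : Type*} [NormedAddCommGroup E] {f : ℝ → E} {p : ℝ≥0∞}
    (hf : MemLp f p μ₄) : MemLp (fun x => f ((x + 2) / 4)) p μ₄ :=
  (hf.of_measure_le_smul ENNReal.ofNat_ne_top map_add_two_div_four_le).comp_of_map (by fun_prop)

lemma integral_selfAffineMeasure_four {E : Type*} [NormedAddCommGroup E] [NormedSpace ℝ E]
    {f : ℝ → E} (hf : Integrable f μ₄) :
    ∫ x, f x ∂μ₄ = ∫ x, (2 : ℝ)⁻¹ • (f (x / 4) + f ((x + 2) / 4)) ∂μ₄ := by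
  have h0 : Integrable f (Measure.map (fun x => x / 4) μ₄) :=
    hf.of_measure_le_smul ENNReal.ofNat_ne_top map_div_four_le
  have h2 : Integrable f (Measure.map (fun x => (x + 2) / 4) μ₄) :=
    hf.of_measure_le_smul ENNReal.ofNat_ne_top map_add_two_div_four_le
  conv_lhs => rw [selfAffineMeasure_four_eq_smul_add]
  rw [integral_smul_measure, integral_add_measure h0 h2,
    integral_map (by fun_prop) h0.aestronglyMeasurable,
    integral_map (by fun_prop) h2.aestronglyMeasurable, integral_smul, integral_add]
  · simp
  · exact h0.comp_measurable (by fun_prop)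
  · exact h2.comp_measurable (by fun_prop)

/-! ### Exponentials -/

lemma exponential_eq (lam x : ℝ) :
    exponential lam x = Complex.exp ((2 * Real.pi * lam * x : ℝ) * Complex.I) := by
  rw [exponential]
  congr 1
  push_cast
  ring

@[simp] lemma norm_exponential (lam x : ℝ) : ‖exponential lam x‖ = 1 := by
  rw [exponential_eq, Complex.norm_exp_ofReal_mul_I]

lemma continuous_exponential_right (lam : ℝ) : Continuous (exponential lam) := by
  unfold exponential
  fun_prop

lemma exponential_add_left (s t x : ℝ) :
    exponential (s + t) x = exponential s x * exponential t x := by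
  simp only [exponential, ← Complex.exp_add]
  congr 1
  push_cast
  ring

lemma exponential_add_right (s x y : ℝ) :
    exponential s (x + y) = exponential s x * exponential s y := by
  simp only [exponential, ← Complex.exp_add]
  congr 1
  push_cast
  ring

lemma exponential_mul (s t x : ℝ) : exponential (s * t) x = exponential s (t * x) := by
  simp only [exponential]
  congr 1
  push_cast
  ring

@[simp] lemma exponential_zero_left (x : ℝ) : exponential 0 x = 1 := by simp [exponential]

lemma exponential_neg_left (s x : ℝ) :
    exponential (-s) x = (starRingEnd ℂ) (exponential s x) := by
  simp only [exponential_eq, ← Complex.exp_conj, map_mul, Complex.conj_ofReal, Complex.conj_I]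
  congr 1
  push_cast
  ring

lemma exponential_intCast (n : ℤ) : exponential n 1 = 1 := by
  rw [exponential, Complex.exp_eq_one_iff]
  exact ⟨n, by push_cast; ring⟩

lemma exponential_half (t : ℝ) : exponential t (1 / 2) = Complex.exp (Real.pi * Complex.I * t) := by
  rw [exponential]
  congr 1
  push_cast
  ring

lemma exponential_half_of_even {n : ℤ} (h : Even n) : exponential n (1 / 2) = 1 := by
  obtain ⟨k, rfl⟩ := h
  rw [exponential, Complex.exp_eq_one_iff]
  exact ⟨k, by push_cast; ring⟩

lemma exponential_half_of_odd {n : ℤ} (h : Odd n) : exponential n (1 / 2) = -1 := by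
  obtain ⟨k, rfl⟩ := h
  rw [exponential_half, ← Complex.exp_pi_mul_I, Complex.exp_eq_exp_iff_exists_int]
  exact ⟨k, by push_cast; ring⟩

/-- Locates the zeros of the transition weights: `1 + e_t(1/2)` vanishes only at odd integers. -/
lemma exists_odd_of_exponential_half {t : ℝ} (h : exponential t (1 / 2) = -1) :
    ∃ n : ℤ, Odd n ∧ t = n := by
  rw [exponential_half, ← Complex.exp_pi_mul_I, Complex.exp_eq_exp_iff_exists_int] at h
  obtain ⟨k, hk⟩ := h
  refine ⟨2 * k + 1, ⟨k, rfl⟩, ?_⟩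
  have h0 : (Real.pi : ℂ) * Complex.I ≠ 0 := by simp [Real.pi_ne_zero]
  have : (t : ℂ) = 2 * k + 1 := by
    apply mul_left_cancel₀ h0
    rw [hk]
    ring
  exact_mod_cast this

/-! ### The adjoint isometries -/

/-- The adjoint of the isometry of `L²(μ₄)` that maps `e_k` to `e_{l + 4k}`. -/
noncomputable def branchAdjoint (l : ℤ) (f : ℝ → ℂ) (x : ℝ) : ℂ :=
  (2 : ℝ)⁻¹ • (exponential (-l) (x / 4) * f (x / 4)
    + exponential (-l) ((x + 2) / 4) * f ((x + 2) / 4))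

lemma memLp_exponential_mul {f : ℝ → ℂ} {p : ℝ≥0∞} (hf : MemLp f p μ₄) (t : ℝ) :
    MemLp (fun x => exponential t x * f x) p μ₄ :=
  hf.of_le ((continuous_exponential_right t).aestronglyMeasurable.mul hf.1)
    (Filter.Eventually.of_forall fun x => by simp)

lemma memLp_branchAdjoint {f : ℝ → ℂ} (hf : MemLp f 2 μ₄) (l : ℤ) :
    MemLp (branchAdjoint l f) 2 μ₄ :=
  ((memLp_comp_div_four (memLp_exponential_mul hf (-l))).add
    (memLp_comp_add_two_div_four (memLp_exponential_mul hf (-l)))).const_smul (2 : ℝ)⁻¹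

/-- The Fourier coefficient `∫ e_{-t} f dμ₄`. -/
noncomputable def coefficient (f : ℝ → ℂ) (t : ℝ) : ℂ := ∫ x, exponential (-t) x * f x ∂μ₄

/-- On either branch `e_{-4k}` becomes `e_{-k}`, because `e_{-k}` has period `1` and does not see
the shift by `2`; the factor `e_{-l}` goes into the adjoint. -/
lemma coefficient_add_four_mul {f : ℝ → ℂ} (hf : MemLp f 2 μ₄) (l k : ℤ) :
    coefficient f ((l + 4 * k : ℤ) : ℝ) = coefficient (branchAdjoint l f) k := by
  have hint := (memLp_exponential_mul hf (-((l + 4 * k : ℤ) : ℝ))).integrable one_le_two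
  rw [coefficient, integral_selfAffineMeasure_four hint, coefficient]
  congr 1 with x
  have h1 : -((l + 4 * k : ℤ) : ℝ) = -l + -k * 4 := by push_cast; ring
  have h2 : exponential (-k) (x + 2) = exponential (-k) x := by
    have := exponential_intCast (-k)
    push_cast at this
    rw [show x + 2 = x + 1 + 1 by ring, exponential_add_right, exponential_add_right, this,
      mul_one, mul_one]
  rw [branchAdjoint, mul_smul_comm, h1, exponential_add_left, exponential_add_left,
    exponential_mul, exponential_mul, mul_div_cancel₀ _ (by norm_num : (4 : ℝ) ≠ 0),
    mul_div_cancel₀ _ (by norm_num : (4 : ℝ) ≠ 0), h2]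
  congr 1
  ring

/-- The letter `0` contributes `‖a + b‖²` and the odd letters together `‖a - b‖²`, because their
weights sum to `2 - 1 = 1`; then the parallelogram law applies. -/
lemma sum_norm_sq_add_mul {L : Finset ℤ} {α : ℤ → ℂ} (h_zero_mem : (0 : ℤ) ∈ L)
    (h_odd : ∀ l ∈ L, l ≠ 0 → Odd l) (h_one : α 0 = 1) (h_sum : ∑ l ∈ L, ‖α l‖ ^ 2 = 2)
    (a b : ℂ) :
    ∑ l ∈ L, ‖α l‖ ^ 2 * ‖a + exponential (-l) (1 / 2) * b‖ ^ 2
      = 2 * (‖a‖ ^ 2 + ‖b‖ ^ 2) := by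
  rw [← Finset.add_sum_erase _ _ h_zero_mem] at h_sum ⊢
  have h1 : ∀ l ∈ L.erase 0, ‖α l‖ ^ 2 * ‖a + exponential (-l) (1 / 2) * b‖ ^ 2
      = ‖α l‖ ^ 2 * ‖a - b‖ ^ 2 := by
    intro l hl
    have := exponential_half_of_odd
      (h_odd l (Finset.mem_of_mem_erase hl) (Finset.ne_of_mem_erase hl)).neg
    push_cast at this
    rw [this, neg_one_mul, sub_eq_add_neg]
  rw [Finset.sum_congr rfl h1, ← Finset.sum_mul]
  simp only [h_one, norm_one, one_pow] at h_sum ⊢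
  have h2 : ∑ l ∈ L.erase 0, ‖α l‖ ^ 2 = 1 := by linarith
  have h3 := parallelogram_law_with_norm ℂ a b
  rw [h2]
  simp only [Int.cast_zero, neg_zero, exponential_zero_left, one_mul]
  linarith

lemma norm_branchAdjoint_sq (l : ℤ) (f : ℝ → ℂ) (x : ℝ) :
    ‖branchAdjoint l f x‖ ^ 2
      = 4⁻¹ * ‖f (x / 4) + exponential (-l) (1 / 2) * f ((x + 2) / 4)‖ ^ 2 := by
  have : branchAdjoint l f x = exponential (-l) (x / 4) *
      ((2 : ℝ)⁻¹ • (f (x / 4) + exponential (-l) (1 / 2) * f ((x + 2) / 4))) := by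
    rw [branchAdjoint, mul_smul_comm, show (x + 2) / 4 = x / 4 + 1 / 2 by ring,
      exponential_add_right]
    congr 1
    ring
  rw [this, norm_mul, norm_exponential, one_mul, norm_smul, mul_pow]
  norm_num

lemma sum_integral_norm_branchAdjoint_sq {L : Finset ℤ} {α : ℤ → ℂ} (h_zero_mem : (0 : ℤ) ∈ L)
    (h_odd : ∀ l ∈ L, l ≠ 0 → Odd l) (h_one : α 0 = 1) (h_sum : ∑ l ∈ L, ‖α l‖ ^ 2 = 2)
    {f : ℝ → ℂ} (hf : MemLp f 2 μ₄) :
    ∑ l ∈ L, ‖α l‖ ^ 2 * ∫ x, ‖branchAdjoint l f x‖ ^ 2 ∂μ₄ = ∫ x, ‖f x‖ ^ 2 ∂μ₄ := by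
  rw [integral_selfAffineMeasure_four hf.norm.integrable_sq]
  simp_rw [← integral_const_mul]
  rw [← integral_finsetSum]
  · congr 1 with x
    simp_rw [norm_branchAdjoint_sq]
    have := sum_norm_sq_add_mul h_zero_mem h_odd h_one h_sum (f (x / 4)) (f ((x + 2) / 4))
    rw [smul_eq_mul, show (2 : ℝ)⁻¹ * (‖f (x / 4)‖ ^ 2 + ‖f ((x + 2) / 4)‖ ^ 2)
      = 4⁻¹ * (2 * (‖f (x / 4)‖ ^ 2 + ‖f ((x + 2) / 4)‖ ^ 2)) by ring, ← this, Finset.mul_sum]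
    exact Finset.sum_congr rfl fun l _ => by ring
  · intro l _
    exact (memLp_branchAdjoint hf l).norm.integrable_sq.const_mul _

/-- The two branch terms differ by the constant phase `e_{t-l}(1/2)`, so exponentials remain
exponentials up to a scalar and only the frequency moves. -/
lemma branchAdjoint_exponential (l : ℤ) (t : ℝ) :
    branchAdjoint l (exponential t) = fun x =>
      ((1 + exponential (t - l) (1 / 2)) / 2) * exponential ((t - l) / 4) x := by
  ext x
  have h : ∀ y, exponential ((t - l) / 4) y = exponential (t - l) (y / 4) := fun y => by
    rw [div_eq_mul_inv, exponential_mul, inv_mul_eq_div]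
  rw [branchAdjoint, ← exponential_add_left, ← exponential_add_left, neg_add_eq_sub, h,
    show (x + 2) / 4 = x / 4 + 1 / 2 by ring, exponential_add_right, Complex.real_smul]
  push_cast
  ring

lemma norm_coefficient_sq_le {f : ℝ → ℂ} (hf : MemLp f 2 μ₄) :
    ‖coefficient f 0‖ ^ 2 ≤ ∫ x, ‖f x‖ ^ 2 ∂μ₄ := by
  have h1 : ‖coefficient f 0‖ ≤ ∫ x, ‖f x‖ ∂μ₄ := by
    simpa [coefficient] using norm_integral_le_integral_norm (μ := μ₄) f
  -- Nonnegative variance is the inequality `(∫ ‖f‖)² ≤ ∫ ‖f‖²`.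
  have h2 := variance_nonneg (fun x => ‖f x‖) μ₄
  rw [variance_eq_sub hf.norm] at h2
  have h3 := pow_le_pow_left₀ (norm_nonneg _) h1 2
  simp only [Pi.pow_apply] at h2
  linarith

/-! ### Words -/

lemma nil_mem_wordSet (L : Finset ℤ) : [] ∈ wordSet L := by simp [wordSet]

lemma cons_mem_wordSet {L : Finset ℤ} {l : ℤ} {w : List ℤ} :
    l :: w ∈ wordSet L ↔ l ∈ L ∧ w ∈ wordSet L ∧ (w = [] → l ≠ 0) := by
  cases w with
  | nil => simp [wordSet]
  | cons a w => simp [wordSet, and_assoc]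

lemma wordFrequency_cons (R l : ℤ) (w : List ℤ) :
    wordFrequency R (l :: w) = l + R * wordFrequency R w := by
  simp only [wordFrequency, List.length_cons]
  rw [Fin.sum_univ_succ, Finset.mul_sum]
  simp [pow_succ', mul_assoc]

/-- The first letter and the rest of a word, padded by a letter `0` if it is empty. -/
noncomputable def wordSetEquiv (L : Finset ℤ) (h0 : (0 : ℤ) ∈ L) : wordSet L ≃ L × wordSet L where
  toFun
    | ⟨[], _⟩ => (⟨0, h0⟩, ⟨[], nil_mem_wordSet L⟩)
    | ⟨l :: w, h⟩ => (⟨l, (cons_mem_wordSet.1 h).1⟩, ⟨w, (cons_mem_wordSet.1 h).2.1⟩)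
  invFun p :=
    -- The word `0` is not in `Ω(L)`, so this pair is free to represent the empty word.
    if h : (p.2 : List ℤ) = [] ∧ (p.1 : ℤ) = 0 then ⟨[], nil_mem_wordSet L⟩
    else ⟨p.1 :: p.2, cons_mem_wordSet.2 ⟨p.1.2, p.2.2, fun h1 h2 => h ⟨h1, h2⟩⟩⟩
  left_inv := by
    rintro ⟨_ | ⟨l, w⟩, h⟩
    · simp
    · have := (cons_mem_wordSet.1 h).2.2
      exact dif_neg fun h' => this h'.1 h'.2
  right_inv := by
    rintro ⟨⟨l, hl⟩, ⟨w, hw⟩⟩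
    by_cases h : w = [] ∧ l = 0
    · obtain ⟨rfl, rfl⟩ := h
      simp
    · simp [h]

/-- The squared modulus of the inner product of `f` with the member of the family that belongs
to the word `w`. -/
noncomputable def wordEnergy (α : ℤ → ℂ) (f : ℝ → ℂ) (w : List ℤ) : ℝ :=
  ‖wordWeight α w‖ ^ 2 * ‖coefficient f (wordFrequency 4 w)‖ ^ 2

lemma wordEnergy_nonneg (α : ℤ → ℂ) (f : ℝ → ℂ) (w : List ℤ) : 0 ≤ wordEnergy α f w := by
  unfold wordEnergy
  positivity

lemma wordEnergy_nil (α : ℤ → ℂ) (f : ℝ → ℂ) :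
    wordEnergy α f [] = ‖coefficient f 0‖ ^ 2 := by
  simp [wordEnergy, wordWeight, wordFrequency]

lemma wordEnergy_cons (α : ℤ → ℂ) {f : ℝ → ℂ} (hf : MemLp f 2 μ₄) (l : ℤ) (w : List ℤ) :
    wordEnergy α f (l :: w) = ‖α l‖ ^ 2 * wordEnergy α (branchAdjoint l f) w := by
  simp only [wordEnergy, wordFrequency_cons, coefficient_add_four_mul hf]
  simp only [wordWeight, List.map_cons, List.prod_cons, norm_mul, mul_pow, mul_assoc]

/-- The padding letter of the empty word costs nothing, since `α 0 = 1` and `0 = 0 + 4 * 0`. -/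
lemma wordEnergy_eq {L : Finset ℤ} {α : ℤ → ℂ} (h0 : (0 : ℤ) ∈ L) (h_one : α 0 = 1)
    {f : ℝ → ℂ} (hf : MemLp f 2 μ₄) (w : wordSet L) :
    wordEnergy α f w = ‖α (wordSetEquiv L h0 w).1‖ ^ 2 *
      wordEnergy α (branchAdjoint (wordSetEquiv L h0 w).1 f) (wordSetEquiv L h0 w).2 := by
  obtain ⟨_ | ⟨l, w⟩, h⟩ := w
  · have := coefficient_add_four_mul hf 0 0
    norm_num at this
    simp [wordSetEquiv, wordEnergy_nil, h_one, this]
  · exact wordEnergy_cons α hf l w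

lemma length_wordSetEquiv_snd {L : Finset ℤ} (h0 : (0 : ℤ) ∈ L) (w : wordSet L) {n : ℕ}
    (h : (w : List ℤ).length ≤ n + 1) :
    ((wordSetEquiv L h0 w).2 : List ℤ).length ≤ n := by
  obtain ⟨_ | ⟨l, w⟩, hw⟩ := w
  · simp [wordSetEquiv]
  · simpa [wordSetEquiv] using h

/-! ### Bessel bound and recursion for the total energy -/

section

variable {L : Finset ℤ} {α : ℤ → ℂ}

/-- Removing first letters embeds `s` in a product of `L` with a set of shorter words. The induction
hypothesis bounds each fibre, and the norm identity for the adjoints sums the bounds exactly. -/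
lemma sum_wordEnergy_le_of_length_le (h0 : (0 : ℤ) ∈ L) (h_odd : ∀ l ∈ L, l ≠ 0 → Odd l)
    (h_one : α 0 = 1) (h_sum : ∑ l ∈ L, ‖α l‖ ^ 2 = 2) (n : ℕ) {f : ℝ → ℂ}
    (hf : MemLp f 2 μ₄) (s : Finset (wordSet L)) (hs : ∀ w ∈ s, (w : List ℤ).length ≤ n) :
    ∑ w ∈ s, wordEnergy α f w ≤ ∫ x, ‖f x‖ ^ 2 ∂μ₄ := by
  classical
  induction n generalizing f s with
  | zero =>
    have hsub : s ⊆ {⟨[], nil_mem_wordSet L⟩} := by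
      intro w hw
      rw [Finset.mem_singleton]
      exact Subtype.ext (List.length_eq_zero_iff.1 (Nat.le_zero.1 (hs w hw)))
    refine (Finset.sum_le_sum_of_subset_of_nonneg hsub
      fun w _ _ => wordEnergy_nonneg α f w).trans ?_
    rw [Finset.sum_singleton, wordEnergy_nil]
    exact norm_coefficient_sq_le hf
  | succ n ih =>
    set s' := s.image fun w => (wordSetEquiv L h0 w).2
    have hs' : ∀ w ∈ s', (w : List ℤ).length ≤ n := by
      intro w hw
      obtain ⟨v, hv, rfl⟩ := Finset.mem_image.1 hw
      exact length_wordSetEquiv_snd h0 v (hs v hv)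
    have hsub : s.map (wordSetEquiv L h0).toEmbedding ⊆ Finset.univ ×ˢ s' := by
      intro p hp
      obtain ⟨v, hv, rfl⟩ := Finset.mem_map.1 hp
      exact Finset.mem_product.2 ⟨Finset.mem_univ _, Finset.mem_image_of_mem _ hv⟩
    calc ∑ w ∈ s, wordEnergy α f w
        = ∑ p ∈ s.map (wordSetEquiv L h0).toEmbedding,
            ‖α p.1‖ ^ 2 * wordEnergy α (branchAdjoint p.1 f) p.2 := by
          rw [Finset.sum_map]
          exact Finset.sum_congr rfl fun w _ => wordEnergy_eq h0 h_one hf w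
      _ ≤ ∑ p ∈ (Finset.univ : Finset L) ×ˢ s',
            ‖α p.1‖ ^ 2 * wordEnergy α (branchAdjoint p.1 f) p.2 :=
          Finset.sum_le_sum_of_subset_of_nonneg hsub fun p _ _ =>
            mul_nonneg (sq_nonneg _) (wordEnergy_nonneg _ _ _)
      _ = ∑ l : L, ‖α l‖ ^ 2 * ∑ w ∈ s', wordEnergy α (branchAdjoint l f) w := by
          rw [Finset.sum_product]
          simp_rw [Finset.mul_sum]
      _ ≤ ∑ l : L, ‖α l‖ ^ 2 * ∫ x, ‖branchAdjoint l f x‖ ^ 2 ∂μ₄ := by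
          refine Finset.sum_le_sum fun l _ => ?_
          exact mul_le_mul_of_nonneg_left (ih (memLp_branchAdjoint hf l) s' hs') (sq_nonneg _)
      _ = ∫ x, ‖f x‖ ^ 2 ∂μ₄ := by
          rw [← sum_integral_norm_branchAdjoint_sq h0 h_odd h_one h_sum hf,
            Finset.sum_coe_sort L fun l => ‖α l‖ ^ 2 * ∫ x, ‖branchAdjoint l f x‖ ^ 2 ∂μ₄]

/-- The family is a Bessel family with bound `1`. -/
lemma sum_wordEnergy_le (h0 : (0 : ℤ) ∈ L) (h_odd : ∀ l ∈ L, l ≠ 0 → Odd l)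
    (h_one : α 0 = 1) (h_sum : ∑ l ∈ L, ‖α l‖ ^ 2 = 2) {f : ℝ → ℂ}
    (hf : MemLp f 2 μ₄) (s : Finset (wordSet L)) :
    ∑ w ∈ s, wordEnergy α f w ≤ ∫ x, ‖f x‖ ^ 2 ∂μ₄ :=
  sum_wordEnergy_le_of_length_le h0 h_odd h_one h_sum (s.sup fun w => (w : List ℤ).length) hf s
    fun _ hw => Finset.le_sup (f := fun w : wordSet L => (w : List ℤ).length) hw

lemma summable_wordEnergy (h0 : (0 : ℤ) ∈ L) (h_odd : ∀ l ∈ L, l ≠ 0 → Odd l)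
    (h_one : α 0 = 1) (h_sum : ∑ l ∈ L, ‖α l‖ ^ 2 = 2) {f : ℝ → ℂ} (hf : MemLp f 2 μ₄) :
    Summable fun w : wordSet L => wordEnergy α f w :=
  summable_of_sum_le (fun _ => wordEnergy_nonneg _ _ _)
    (sum_wordEnergy_le h0 h_odd h_one h_sum hf)

lemma tsum_wordEnergy_eq_sum (h0 : (0 : ℤ) ∈ L) (h_odd : ∀ l ∈ L, l ≠ 0 → Odd l)
    (h_one : α 0 = 1) (h_sum : ∑ l ∈ L, ‖α l‖ ^ 2 = 2) {f : ℝ → ℂ} (hf : MemLp f 2 μ₄) :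
    ∑' w : wordSet L, wordEnergy α f w
      = ∑ l ∈ L, ‖α l‖ ^ 2 * ∑' w : wordSet L, wordEnergy α (branchAdjoint l f) w := by
  have hs := summable_wordEnergy h0 h_odd h_one h_sum hf
  let F : L × wordSet L → ℝ := fun p => ‖α p.1‖ ^ 2 * wordEnergy α (branchAdjoint p.1 f) p.2
  have hF : (fun w : wordSet L => wordEnergy α f w) = F ∘ wordSetEquiv L h0 :=
    funext fun w => wordEnergy_eq h0 h_one hf w
  have hFs : Summable F := (wordSetEquiv L h0).summable_iff.1 (hF ▸ hs)
  calc ∑' w : wordSet L, wordEnergy α f w = ∑' w, F (wordSetEquiv L h0 w) :=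
        congrArg tsum hF
    _ = ∑' p, F p := (wordSetEquiv L h0).tsum_eq F
    _ = ∑' l, ∑' w, F (l, w) := hFs.tsum_prod
    _ = ∑ l : L, ‖α l‖ ^ 2 * ∑' w : wordSet L, wordEnergy α (branchAdjoint l f) w := by
        rw [tsum_fintype]
        exact Finset.sum_congr rfl fun l _ => by simp only [F, tsum_mul_left]
    _ = _ := Finset.sum_coe_sort L
        fun l => ‖α l‖ ^ 2 * ∑' w : wordSet L, wordEnergy α (branchAdjoint l f) w

end

/-! ### Minima of fixed points of the transfer operator -/

lemma one_add_exponential_half_ne_zero {s : ℝ} (h : ∀ n : ℤ, Odd n → s ≠ n) :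
    1 + exponential s (1 / 2) ≠ 0 := by
  intro h0
  obtain ⟨n, hn, rfl⟩ := exists_odd_of_exponential_half (eq_neg_of_add_eq_zero_right h0)
  exact h n hn rfl

/-- Makes every cycle of integers extreme. -/
lemma norm_maskFunction_intCast (n : ℤ) : ‖maskFunction {0, 2} n‖ = 1 := by
  have h : Complex.exp (2 * Real.pi * Complex.I * 2 * n) = 1 := by
    rw [Complex.exp_eq_one_iff]
    exact ⟨2 * n, by push_cast; ring⟩
  rw [maskFunction, Finset.sum_pair (by norm_num), Finset.card_pair (by norm_num)]
  push_cast
  rw [h]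
  norm_num

/-- A self-map of a finite set of integers that inverts `t ↦ 4t` or `t ↦ 4t + l` has a periodic
orbit, which is an extreme cycle. -/
lemma zero_mem_of_forall_extremeCycle {l : ℤ} {K : Set ℤ} (hK : K.Finite) (hne : K.Nonempty)
    (hstep : ∀ n ∈ K, ∃ m ∈ K, ∃ d ∈ ({0, l} : Finset ℤ), n = 4 * m + d)
    (hcyc : ∀ C : Set ℝ, IsExtremeCycle 4 {0, 2} {0, l} C → C = {0}) : (0 : ℤ) ∈ K := by
  choose! g hg d hd hgd using hstep
  obtain ⟨n, hn⟩ := hne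
  have horb : ∀ i, g^[i] n ∈ K := by
    intro i
    induction i with
    | zero => exact hn
    | succ i ih => rw [Function.iterate_succ_apply']; exact hg _ ih
  -- Pigeonhole: an orbit in a finite set repeats, and the stretch from `i` to `j` closes up into a
  -- cycle.
  obtain ⟨i, j, hij, heq⟩ : ∃ i j, i < j ∧ g^[i] n = g^[j] n := by
    have : ¬ Function.Injective fun i => g^[i] n := fun hinj =>
      Set.infinite_univ (Set.Finite.of_finite_image
        (hK.subset (by rintro _ ⟨i, -, rfl⟩; exact horb i)) hinj.injOn)
    simp only [Function.Injective, not_forall] at this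
    obtain ⟨i, j, h, hne⟩ := this
    rcases lt_or_gt_of_ne hne with h1 | h1
    · exact ⟨i, j, h1, h⟩
    · exact ⟨j, i, h1, h.symm⟩
  let t : ℕ → ℝ := fun k => (g^[i + k] n : ℤ)
  have hC : IsExtremeCycle 4 {0, 2} {0, l} (t '' Set.Iio (j - i)) := by
    refine ⟨⟨j - i, t, fun k => d (g^[i + k] n), by omega, fun k _ => hd _ (horb _),
      fun k _ => ?_, ?_, rfl⟩, ?_⟩
    · have := hgd _ (horb (i + k))
      rw [← Function.iterate_succ_apply' g] at this
      have h' : ((g^[i + k] n : ℤ) : ℝ)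
          = 4 * (g^[(i + k).succ] n : ℤ) + (d (g^[i + k] n) : ℤ) := by exact_mod_cast this
      simp only [t]
      rw [h', show i + (k + 1) = (i + k).succ from rfl]
      push_cast
      ring
    · simp only [t]
      rw [Nat.add_sub_cancel' hij.le, add_zero, heq]
    · rintro _ ⟨k, -, rfl⟩
      exact norm_maskFunction_intCast _
  have h0 : t 0 ∈ t '' Set.Iio (j - i) := ⟨0, by simp [hij], rfl⟩
  rw [hcyc _ hC] at h0
  have h1 : g^[i] n = 0 := by simpa [t] using h0
  exact h1 ▸ horb i

/-- For `n` of minimal absolute value, `n = 4m` with `m ∈ K` forces `4|m| ≤ |m|`. -/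
lemma zero_mem_of_forall_eq_four_mul {K : Set ℤ} (hK : K.Finite) (hne : K.Nonempty)
    (hstep : ∀ n ∈ K, ∃ m ∈ K, n = 4 * m) : (0 : ℤ) ∈ K := by
  obtain ⟨n, hn, hmin⟩ := hK.exists_minimalFor Int.natAbs K hne
  obtain ⟨m, hm, h⟩ := hstep n hn
  have := hmin hm (by omega)
  have h0 : m = 0 := by omega
  exact h0 ▸ hm

/-- A nonempty compact set that is invariant under the transitions of positive weight
contains `0`. -/
lemma zero_mem_of_isCompact_of_invariant {L : Finset ℤ} (h_zero_mem : (0 : ℤ) ∈ L)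
    (h_odd : ∀ l ∈ L, l ≠ 0 → Odd l)
    (h_cond :
      (∃ l₀ ∈ L, ∃ l₁ ∈ L, l₀ ≡ 1 [ZMOD 4] ∧ l₁ ≡ 3 [ZMOD 4]) ∨
      (∃ l₀ ∈ L, l₀ ≠ 0 ∧ ∀ C : Set ℝ, IsExtremeCycle 4 {0, 2} {0, l₀} C → C = {0}))
    {K : Set ℝ} (hK : IsCompact K) (hne : K.Nonempty)
    (hinv : ∀ t ∈ K, ∀ l ∈ L, 1 + exponential (t - l) (1 / 2) ≠ 0 → (t - l) / 4 ∈ K) :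
    (0 : ℝ) ∈ K := by
  by_cases hint : ∀ t ∈ K, ∃ n : ℤ, t = n
  · let K' : Set ℤ := {n | (n : ℝ) ∈ K}
    have hK'fin : K'.Finite := by
      obtain ⟨r, hr⟩ := hK.isBounded.subset_closedBall 0
      refine (Set.finite_Icc (-⌈r⌉) ⌈r⌉).subset fun n hn => ?_
      have h1 := hr hn
      rw [mem_closedBall_zero_iff, Real.norm_eq_abs, abs_le] at h1
      have h2 := Int.le_ceil r
      constructor
      · have : ((-⌈r⌉ : ℤ) : ℝ) ≤ n := by push_cast; linarith
        exact_mod_cast this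
      · have : (n : ℝ) ≤ ⌈r⌉ := by linarith
        exact_mod_cast this
    have hK'ne : K'.Nonempty := by
      obtain ⟨t, ht⟩ := hne
      obtain ⟨n, rfl⟩ := hint t ht
      exact ⟨n, ht⟩
    -- For `n - l` even the weight is positive, so `(n - l) / 4` lies in `K` and must be an integer.
    have hK'inv : ∀ n ∈ K', ∀ l ∈ L, Even (n - l) → ∃ m ∈ K', n = 4 * m + l := by
      intro n hn l hl heven
      have h1 : 1 + exponential ((n : ℝ) - l) (1 / 2) ≠ 0 := by
        have := exponential_half_of_even heven
        push_cast at this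
        rw [this]
        norm_num
      have h2 := hinv n hn l hl h1
      obtain ⟨m, hm⟩ := hint _ h2
      refine ⟨m, by rw [hm] at h2; exact h2, ?_⟩
      have : (n : ℝ) = 4 * m + l := by linarith
      exact_mod_cast this
    suffices (0 : ℤ) ∈ K' by simpa [K'] using this
    rcases h_cond with ⟨l₀, hl₀, l₁, hl₁, h₀, h₁⟩ | ⟨l₀, hl₀, hne₀, hcyc⟩
    · have hl₀' : l₀ % 4 = 1 := h₀
      have hl₁' : l₁ % 4 = 3 := h₁
      -- For odd `n`, both `n - l₀` and `n - l₁` would be divisible by `4`, against `l₁ - l₀ ≡ 2`.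
      have heven : ∀ n ∈ K', Even n := by
        intro n hn
        by_contra hodd
        rw [Int.not_even_iff] at hodd
        obtain ⟨m, -, hm⟩ := hK'inv n hn l₀ hl₀ (by rw [Int.even_iff]; omega)
        obtain ⟨m', -, hm'⟩ := hK'inv n hn l₁ hl₁ (by rw [Int.even_iff]; omega)
        omega
      refine zero_mem_of_forall_eq_four_mul hK'fin hK'ne fun n hn => ?_
      simpa using hK'inv n hn 0 h_zero_mem (by simpa using heven n hn)
    · refine zero_mem_of_forall_extremeCycle hK'fin hK'ne (fun n hn => ?_) hcyc
      rcases Int.even_or_odd n with he | ho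
      · obtain ⟨m, hm, h⟩ := hK'inv n hn 0 h_zero_mem (by simpa using he)
        exact ⟨m, hm, 0, by simp, h⟩
      · obtain ⟨m, hm, h⟩ := hK'inv n hn l₀ hl₀ (ho.sub_odd (h_odd l₀ hl₀ hne₀))
        exact ⟨m, hm, l₀, by simp, h⟩
  · push Not at hint
    obtain ⟨t, ht, htn⟩ := hint
    -- At a noninteger the letter `0` has positive weight, and a quarter of a noninteger is again
    -- one.
    have hseq : ∀ k : ℕ, t * (1 / 4) ^ k ∈ K ∧ ∀ n : ℤ, t * (1 / 4) ^ k ≠ n := by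
      intro k
      induction k with
      | zero => simpa using ⟨ht, htn⟩
      | succ k ih =>
        have h1 := hinv _ ih.1 0 h_zero_mem (one_add_exponential_half_ne_zero fun n _ => by
          simpa using ih.2 n)
        have h2 : (t * (1 / 4) ^ k - ((0 : ℤ) : ℝ)) / 4 = t * (1 / 4) ^ (k + 1) := by
          rw [pow_succ]
          push_cast
          ring
        rw [h2] at h1
        refine ⟨h1, fun n hn => ih.2 (4 * n) ?_⟩
        rw [pow_succ] at hn
        push_cast
        linarith
    have hlim : Filter.Tendsto (fun k : ℕ => t * (1 / 4) ^ k) Filter.atTop (nhds 0) := by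
      simpa using (tendsto_pow_atTop_nhds_zero_of_lt_one (r := (1 / 4 : ℝ)) (by norm_num)
        (by norm_num)).const_mul t
    exact hK.isClosed.mem_of_tendsto hlim (Filter.Eventually.of_forall fun k => (hseq k).1)

/-! ### The energy of `e_t` as a function of `t` -/

section

variable {L : Finset ℤ} {α : ℤ → ℂ}

lemma integral_norm_exponential_sq (t : ℝ) : ∫ x, ‖exponential t x‖ ^ 2 ∂μ₄ = 1 := by simp

/-- The norm identity for the adjoints, applied to the unit vector `e_t`. -/
lemma sum_weight_eq_one (h0 : (0 : ℤ) ∈ L) (h_odd : ∀ l ∈ L, l ≠ 0 → Odd l)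
    (h_one : α 0 = 1) (h_sum : ∑ l ∈ L, ‖α l‖ ^ 2 = 2) (t : ℝ) :
    ∑ l ∈ L, ‖α l‖ ^ 2 * ‖(1 + exponential (t - l) (1 / 2)) / 2‖ ^ 2 = 1 := by
  have h := sum_integral_norm_branchAdjoint_sq h0 h_odd h_one h_sum (memLp_exponential μ₄ t)
  rw [integral_norm_exponential_sq] at h
  simpa [branchAdjoint_exponential] using h

lemma wordEnergy_const_mul (c : ℂ) (f : ℝ → ℂ) (w : List ℤ) :
    wordEnergy α (fun x => c * f x) w = ‖c‖ ^ 2 * wordEnergy α f w := by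
  have : coefficient (fun x => c * f x) (wordFrequency 4 w)
      = c * coefficient f (wordFrequency 4 w) := by
    simp only [coefficient, ← integral_const_mul]
    congr 1 with x
    ring
  rw [wordEnergy, this, norm_mul, mul_pow, wordEnergy]
  ring

/-- The total energy of an exponential is a fixed point of the transfer operator. -/
lemma tsum_wordEnergy_exponential (h0 : (0 : ℤ) ∈ L) (h_odd : ∀ l ∈ L, l ≠ 0 → Odd l)
    (h_one : α 0 = 1) (h_sum : ∑ l ∈ L, ‖α l‖ ^ 2 = 2) (t : ℝ) :
    ∑' w : wordSet L, wordEnergy α (exponential t) w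
      = ∑ l ∈ L, ‖α l‖ ^ 2 * ‖(1 + exponential (t - l) (1 / 2)) / 2‖ ^ 2 *
        ∑' w : wordSet L, wordEnergy α (exponential ((t - l) / 4)) w := by
  rw [tsum_wordEnergy_eq_sum h0 h_odd h_one h_sum (memLp_exponential μ₄ t)]
  refine Finset.sum_congr rfl fun l _ => ?_
  simp_rw [branchAdjoint_exponential, wordEnergy_const_mul, tsum_mul_left, mul_assoc]

/-- If the total energy of `e_t` depends continuously on `t`, then it is constantly `1`. -/
lemma tsum_wordEnergy_exponential_eq_one (h_zero_mem : (0 : ℤ) ∈ L)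
    (h_odd : ∀ l ∈ L, l ≠ 0 → Odd l)
    (h_cond :
      (∃ l₀ ∈ L, ∃ l₁ ∈ L, l₀ ≡ 1 [ZMOD 4] ∧ l₁ ≡ 3 [ZMOD 4]) ∨
      (∃ l₀ ∈ L, l₀ ≠ 0 ∧ ∀ C : Set ℝ, IsExtremeCycle 4 {0, 2} {0, l₀} C → C = {0}))
    (h_ne_zero : ∀ l ∈ L, α l ≠ 0) (h_one : α 0 = 1) (h_sum : ∑ l ∈ L, ‖α l‖ ^ 2 = 2)
    (hcont : Continuous fun t : ℝ => ∑' w : wordSet L, wordEnergy α (exponential t) w) (t : ℝ) :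
    ∑' w : wordSet L, wordEnergy α (exponential t) w = 1 := by
  set h : ℝ → ℝ := fun t => ∑' w : wordSet L, wordEnergy α (exponential t) w with h_def
  have hle : ∀ s, h s ≤ 1 := fun s => by
    rw [← integral_norm_exponential_sq s]
    exact Real.tsum_le_of_sum_le (fun _ => wordEnergy_nonneg _ _ _)
      (sum_wordEnergy_le h_zero_mem h_odd h_one h_sum (memLp_exponential μ₄ s))
  have h_zero : 1 ≤ h 0 := by
    have := (summable_wordEnergy h_zero_mem h_odd h_one h_sum (memLp_exponential μ₄ 0)).le_tsum
      ⟨[], nil_mem_wordSet L⟩ fun _ _ => wordEnergy_nonneg _ _ _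
    refine le_trans (le_of_eq ?_) this
    simp [wordEnergy_nil, coefficient]
  have hfix : ∀ s, h s = ∑ l ∈ L,
      ‖α l‖ ^ 2 * ‖(1 + exponential (s - l) (1 / 2)) / 2‖ ^ 2 * h ((s - l) / 4) :=
    tsum_wordEnergy_exponential h_zero_mem h_odd h_one h_sum
  -- `M` bounds `|t|` and every `|l|`, so `|s| ≤ M` gives `|(s - l) / 4| ≤ M / 2`.
  set M : ℝ := |t| + ∑ l ∈ L, |(l : ℝ)| with hM
  have hLM : ∀ l ∈ L, |(l : ℝ)| ≤ M := fun l hl =>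
    (Finset.single_le_sum (f := fun l : ℤ => |(l : ℝ)|) (fun _ _ => abs_nonneg _) hl).trans
      (by rw [hM]; linarith [abs_nonneg t])
  have htM : |t| ≤ M := by
    have : 0 ≤ ∑ l ∈ L, |(l : ℝ)| := Finset.sum_nonneg fun _ _ => abs_nonneg _
    linarith
  have hI : ∀ s ∈ Set.Icc (-M) M, ∀ l ∈ L, (s - l) / 4 ∈ Set.Icc (-M) M := by
    intro s hs l hl
    have h1 := abs_le.1 (hLM l hl)
    have h2 := hs.1
    have h3 := hs.2
    constructor <;> linarith [h1.1, h1.2]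
  have htI : t ∈ Set.Icc (-M) M := abs_le.1 htM
  obtain ⟨s₀, hs₀, hmin⟩ := isCompact_Icc.exists_isMinOn ⟨t, htI⟩ hcont.continuousOn
  have hmin' : ∀ s ∈ Set.Icc (-M) M, h s₀ ≤ h s := fun s hs => hmin hs
  have hK : IsCompact (Set.Icc (-M) M ∩ h ⁻¹' {h s₀}) :=
    isCompact_Icc.inter_right (isClosed_singleton.preimage hcont)
  have hmem := zero_mem_of_isCompact_of_invariant h_zero_mem h_odd h_cond hK ⟨s₀, hs₀, rfl⟩ (by
    rintro s ⟨hsI, hs⟩ l hl hne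
    refine ⟨hI s hsI l hl, ?_⟩
    have hs' : h s = h s₀ := hs
    -- At a minimizer `h` is the weighted mean of values not below the minimum, so every value of
    -- nonzero weight equals it.
    have hsum : ∑ l ∈ L, ‖α l‖ ^ 2 * ‖(1 + exponential (s - l) (1 / 2)) / 2‖ ^ 2 *
        (h ((s - l) / 4) - h s₀) = 0 := by
      simp_rw [mul_sub]
      rw [Finset.sum_sub_distrib, ← hfix, ← Finset.sum_mul,
        sum_weight_eq_one h_zero_mem h_odd h_one h_sum, hs', one_mul, sub_self]
    rw [Finset.sum_eq_zero_iff_of_nonneg fun k hk => mul_nonneg (by positivity)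
      (sub_nonneg.2 (hmin' _ (hI s hsI k hk)))] at hsum
    have hpos : ‖α l‖ ^ 2 * ‖(1 + exponential (s - l) (1 / 2)) / 2‖ ^ 2 ≠ 0 :=
      mul_ne_zero (pow_ne_zero _ (norm_ne_zero_iff.2 (h_ne_zero l hl)))
        (pow_ne_zero _ (norm_ne_zero_iff.2 (div_ne_zero hne two_ne_zero)))
    exact sub_eq_zero.1 ((mul_eq_zero.1 (hsum l hl)).resolve_left hpos))
  have h1 : h 0 = h s₀ := hmem.2
  exact le_antisymm (hle t) (h_zero.trans (h1.trans_le (hmin' t htI)))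

end

/-! ### Bessel families -/

section

variable {ι H : Type*} [NormedAddCommGroup H] [InnerProductSpace ℂ H]

/-- The analysis operator of a Bessel family with bound `1`. -/
noncomputable def analysisOperator (e : ι → H)
    (he : ∀ v (s : Finset ι), ∑ i ∈ s, ‖inner ℂ (e i) v‖ ^ 2 ≤ ‖v‖ ^ 2) :
    H →L[ℂ] lp (fun _ : ι => ℂ) 2 :=
  LinearMap.mkContinuous
    { toFun := fun v => ⟨fun i => inner ℂ (e i) v,
        memℓp_gen' (C := ‖v‖ ^ 2) fun s => by simpa using he v s⟩
      map_add' := fun u v => by ext i; exact inner_add_right _ _ _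
      map_smul' := fun c v => by ext i; exact inner_smul_right _ _ _ } 1 fun v => by
    rw [one_mul]
    refine lp.norm_le_of_forall_sum_le (by norm_num) (norm_nonneg _) fun s => ?_
    simpa using he v s

lemma hasSum_norm_analysisOperator (e : ι → H)
    (he : ∀ v (s : Finset ι), ∑ i ∈ s, ‖inner ℂ (e i) v‖ ^ 2 ≤ ‖v‖ ^ 2) (v : H) :
    HasSum (fun i => ‖inner ℂ v (e i)‖ ^ 2) (‖analysisOperator e he v‖ ^ 2) := by
  have := lp.hasSum_norm (p := 2) (by norm_num) (analysisOperator e he v)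
  simp only [ENNReal.toReal_ofNat, Real.rpow_ofNat] at this
  convert this using 3 with i
  exact norm_inner_symm _ _

lemma norm_analysisOperator_sq_le (e : ι → H)
    (he : ∀ v (s : Finset ι), ∑ i ∈ s, ‖inner ℂ (e i) v‖ ^ 2 ≤ ‖v‖ ^ 2) (v : H) :
    ‖analysisOperator e he v‖ ^ 2 ≤ ‖v‖ ^ 2 := by
  rw [← (hasSum_norm_analysisOperator e he v).tsum_eq]
  simp_rw [norm_inner_symm v]
  exact Real.tsum_le_of_sum_le (fun _ => sq_nonneg _) (he v)

/-- A Bessel family with bound `1` that satisfies the Parseval identity on a set with dense span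
is a Parseval frame. -/
lemma isParsevalFrame_of_dense (e : ι → H)
    (he : ∀ v (s : Finset ι), ∑ i ∈ s, ‖inner ℂ (e i) v‖ ^ 2 ≤ ‖v‖ ^ 2) (S : Set H)
    (hS : (Submodule.span ℂ S).topologicalClosure = ⊤)
    (h : ∀ v ∈ S, ‖analysisOperator e he v‖ ^ 2 = ‖v‖ ^ 2) : IsParsevalFrame e := by
  have hspan : ∀ v ∈ Submodule.span ℂ S, ‖analysisOperator e he v‖ ^ 2 = ‖v‖ ^ 2 := by
    intro v hv
    induction hv using Submodule.span_induction with
    | mem v hv => exact h v hv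
    | zero => simp
    | add u v _ _ hu hv =>
      have h1 := parallelogram_law_with_norm ℂ u v
      have h2 := parallelogram_law_with_norm ℂ (analysisOperator e he u) (analysisOperator e he v)
      rw [← map_add, ← map_sub] at h2
      have h3 := norm_analysisOperator_sq_le e he (u + v)
      have h4 := norm_analysisOperator_sq_le e he (u - v)
      -- The defect `‖v‖² - ‖A v‖²` is nonnegative and obeys the parallelogram law, so zero defect
      -- at `u` and `v` forces it at `u + v`.
      nlinarith
    | smul c v _ hv => rw [map_smul, norm_smul, norm_smul, mul_pow, mul_pow, hv]
  have hclosed : IsClosed {v : H | ‖analysisOperator e he v‖ ^ 2 = ‖v‖ ^ 2} :=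
    isClosed_eq (by fun_prop) (by fun_prop)
  intro v
  have hv : v ∈ closure (Submodule.span ℂ S : Set H) := by
    rw [← Submodule.topologicalClosure_coe, hS]
    trivial
  rw [← (closure_minimal hspan hclosed hv : ‖analysisOperator e he v‖ ^ 2 = ‖v‖ ^ 2)]
  exact hasSum_norm_analysisOperator e he v

end

/-! ### Exponentials in `L²` -/

lemma inner_exponentialL2 (μ : Measure ℝ) [IsFiniteMeasure μ] (t : ℝ) (v : Lp ℂ 2 μ) :
    inner ℂ (exponentialL2 μ t) v = ∫ x, exponential (-t) x * v x ∂μ := by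
  rw [L2.inner_def]
  refine integral_congr_ae ?_
  filter_upwards [(memLp_exponential μ t).coeFn_toLp] with x hx
  rw [exponentialL2, hx, RCLike.inner_apply, exponential_neg_left, mul_comm]

lemma integral_norm_sq_eq_norm_sq {X : Type*} [MeasurableSpace X] {μ : Measure X}
    (v : Lp ℂ 2 μ) : ∫ x, ‖v x‖ ^ 2 ∂μ = ‖v‖ ^ 2 := by
  have h := L2.inner_def (𝕜 := ℂ) v v
  simp only [inner_self_eq_norm_sq_to_K] at h
  have h1 : ∫ x, ((‖v x‖ ^ 2 : ℝ) : ℂ) ∂μ = ((‖v‖ ^ 2 : ℝ) : ℂ) := by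
    push_cast
    exact h.symm
  rw [integral_complex_ofReal] at h1
  exact_mod_cast h1

lemma continuous_exponentialL2 (μ : Measure ℝ) [IsFiniteMeasure μ] :
    Continuous (exponentialL2 μ) := by
  rw [continuous_iff_continuousAt]
  intro t
  rw [ContinuousAt, tendsto_iff_norm_sub_tendsto_zero]
  have hnorm : ∀ s, ‖exponentialL2 μ s - exponentialL2 μ t‖ ^ 2
      = ∫ x, ‖exponential s x - exponential t x‖ ^ 2 ∂μ := by
    intro s
    rw [← integral_norm_sq_eq_norm_sq]
    refine integral_congr_ae ?_
    filter_upwards [Lp.coeFn_sub (exponentialL2 μ s) (exponentialL2 μ t),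
      (memLp_exponential μ s).coeFn_toLp, (memLp_exponential μ t).coeFn_toLp] with x h1 h2 h3
    rw [h1, Pi.sub_apply, exponentialL2, exponentialL2, h2, h3]
  have hlim : Filter.Tendsto (fun s => ∫ x, ‖exponential s x - exponential t x‖ ^ 2 ∂μ)
      (nhds t) (nhds (∫ x, ‖exponential t x - exponential t x‖ ^ 2 ∂μ)) := by
    -- Two numbers of modulus `1` are at distance at most `2`, whence the bound `4`.
    refine tendsto_integral_filter_of_dominated_convergence (fun _ => 4)
      (Filter.Eventually.of_forall fun s => ?_)
      (Filter.Eventually.of_forall fun s => Filter.Eventually.of_forall fun x => ?_)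
      (integrable_const _) (Filter.Eventually.of_forall fun x => ?_)
    · exact (((continuous_exponential_right s).sub
        (continuous_exponential_right t)).norm.pow 2).aestronglyMeasurable
    · have h := norm_sub_le (exponential s x) (exponential t x)
      rw [norm_exponential, norm_exponential] at h
      rw [Real.norm_of_nonneg (sq_nonneg _)]
      nlinarith [norm_nonneg (exponential s x - exponential t x)]
    · have : Continuous fun s => ‖exponential s x - exponential t x‖ ^ 2 := by
        unfold exponential
        fun_prop
      exact this.tendsto t
  simp_rw [← hnorm] at hlim
  simpa using hlim.sqrt

/-- The positive and negative parts of `g` are densities of finite measures with equal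
characteristic functions. The measures agree, so the two parts agree almost everywhere and both
vanish. -/
lemma ae_eq_zero_of_forall_integral_exponential_real {μ : Measure ℝ} [IsFiniteMeasure μ]
    {g : ℝ → ℝ} (hg : Integrable g μ) (h : ∀ t, ∫ x, exponential t x * g x ∂μ = 0) :
    g =ᵐ[μ] 0 := by
  have hfin1 := isFiniteMeasure_withDensity_ofReal hg.2
  have hfin2 := isFiniteMeasure_withDensity_ofReal hg.neg.2
  have hm1 : AEMeasurable (fun x => ENNReal.ofReal (g x)) μ := hg.1.aemeasurable.ennreal_ofReal
  have hm2 : AEMeasurable (fun x => ENNReal.ofReal ((-g) x)) μ :=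
    hg.neg.1.aemeasurable.ennreal_ofReal
  have hint : ∀ (t : ℝ) {f : ℝ → ℝ}, Integrable f μ → Integrable (fun x =>
      (ENNReal.ofReal (f x)).toReal • exponential t x) μ := by
    intro t f hf
    refine hf.norm.mono (hf.1.aemeasurable.ennreal_ofReal.ennreal_toReal.aestronglyMeasurable.smul
      (continuous_exponential_right t).aestronglyMeasurable)
      (Filter.Eventually.of_forall fun x => ?_)
    rw [norm_smul, norm_exponential, mul_one, norm_norm, ENNReal.toReal_ofReal', Real.norm_eq_abs,
      Real.norm_eq_abs]
    rw [abs_of_nonneg (le_max_right _ _)]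
    exact max_le (le_abs_self _) (abs_nonneg _)
  have heq : μ.withDensity (fun x => ENNReal.ofReal (g x))
      = μ.withDensity (fun x => ENNReal.ofReal ((-g) x)) := by
    refine Measure.ext_of_charFun (funext fun s => ?_)
    have hs : ∀ x : ℝ, Complex.exp (s * x * Complex.I) = exponential (s / (2 * Real.pi)) x := by
      intro x
      rw [exponential_eq, mul_div_cancel₀ _ (by positivity)]
      push_cast
      rfl
    rw [charFun_apply_real, charFun_apply_real,
      integral_withDensity_eq_integral_toReal_smul₀ hm1 (by simp),
      integral_withDensity_eq_integral_toReal_smul₀ hm2 (by simp)]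
    simp_rw [hs]
    rw [← sub_eq_zero, ← integral_sub (hint _ hg) (hint _ hg.neg), ← h (s / (2 * Real.pi))]
    refine integral_congr_ae (Filter.Eventually.of_forall fun x => ?_)
    simp only [ENNReal.toReal_ofReal', Pi.neg_apply]
    rw [← sub_smul, max_zero_sub_max_neg_zero_eq_self, Complex.real_smul,
      mul_comm]
  rw [withDensity_eq_iff_of_sigmaFinite hm1 hm2] at heq
  filter_upwards [heq] with x hx
  have := congrArg ENNReal.toReal hx
  rw [ENNReal.toReal_ofReal', ENNReal.toReal_ofReal', Pi.neg_apply] at this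
  rcases le_total (g x) 0 with h0 | h0
  · rw [max_eq_right h0, max_eq_left (by linarith)] at this
    simp only [Pi.zero_apply]
    linarith
  · rw [max_eq_left h0, max_eq_right (by linarith)] at this
    exact this

/-- An integrable function whose Fourier transform vanishes is zero. -/
lemma ae_eq_zero_of_forall_integral_exponential {μ : Measure ℝ} [IsFiniteMeasure μ]
    {g : ℝ → ℂ} (hg : Integrable g μ) (h : ∀ t, ∫ x, exponential t x * g x ∂μ = 0) :
    g =ᵐ[μ] 0 := by
  have hint : ∀ (t : ℝ) {f : ℝ → ℂ}, Integrable f μ →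
      Integrable (fun x => exponential t x * f x) μ := fun t f hf =>
    hf.mono ((continuous_exponential_right t).aestronglyMeasurable.mul hf.1)
      (Filter.Eventually.of_forall fun x => by simp)
  have hgc : Integrable (fun x => (starRingEnd ℂ) (g x)) μ :=
    hg.mono (Complex.continuous_conj.comp_aestronglyMeasurable hg.1)
      (Filter.Eventually.of_forall fun x => by simp)
  -- Conjugation turns frequency `t` into `-t`, so the transform of the conjugate vanishes too, and
  -- with it those of the real and imaginary parts.
  have hconj : ∀ t, ∫ x, exponential t x * (starRingEnd ℂ) (g x) ∂μ = 0 := by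
    intro t
    rw [← map_zero (starRingEnd ℂ), ← h (-t), ← integral_conj]
    refine integral_congr_ae (Filter.Eventually.of_forall fun x => ?_)
    simp [exponential_neg_left]
  have hre := ae_eq_zero_of_forall_integral_exponential_real hg.re fun t => by
    have : ∀ x, exponential t x * ((RCLike.re (g x) : ℝ) : ℂ)
        = 2⁻¹ * (exponential t x * g x + exponential t x * (starRingEnd ℂ) (g x)) := by
      intro x
      rw [← mul_add, RCLike.re_eq_complex_re, Complex.re_eq_add_conj]
      ring
    simp_rw [this]
    rw [integral_const_mul, integral_add (hint t hg) (hint t hgc), h, hconj, add_zero, mul_zero]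
  have him := ae_eq_zero_of_forall_integral_exponential_real hg.im fun t => by
    have : ∀ x, exponential t x * ((RCLike.im (g x) : ℝ) : ℂ)
        = (2 * Complex.I)⁻¹ *
          (exponential t x * g x - exponential t x * (starRingEnd ℂ) (g x)) := by
      intro x
      rw [← mul_sub, RCLike.im_eq_complex_im, Complex.im_eq_sub_conj]
      ring
    simp_rw [this]
    rw [integral_const_mul, integral_sub (hint t hg) (hint t hgc), h, hconj, sub_zero, mul_zero]
  filter_upwards [hre, him] with x h1 h2
  exact Complex.ext h1 h2

/-- The exponentials span a dense subspace of `L²` of a finite measure. -/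
lemma topologicalClosure_span_exponentialL2 (μ : Measure ℝ) [IsFiniteMeasure μ] :
    (Submodule.span ℂ (Set.range (exponentialL2 μ))).topologicalClosure = ⊤ := by
  rw [Submodule.topologicalClosure_eq_top_iff, Submodule.eq_bot_iff]
  intro v hv
  rw [Lp.eq_zero_iff_ae_eq_zero]
  refine ae_eq_zero_of_forall_integral_exponential ((Lp.memLp v).integrable one_le_two) fun t => ?_
  have := (Submodule.mem_orthogonal _ _).1 hv _ (Submodule.subset_span ⟨-t, rfl⟩)
  rwa [inner_exponentialL2, neg_neg] at this

/-! ### From energies to the Parseval identity -/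

lemma norm_inner_smul_exponentialL2_sq (α : ℤ → ℂ) (v : Lp ℂ 2 μ₄) (w : List ℤ) :
    ‖inner ℂ (wordWeight α w • exponentialL2 μ₄ (wordFrequency 4 w)) v‖ ^ 2
      = wordEnergy α v w := by
  rw [inner_smul_left, inner_exponentialL2, norm_mul, mul_pow, RCLike.norm_conj, wordEnergy,
    coefficient]

lemma wordEnergy_congr_ae (α : ℤ → ℂ) {f g : ℝ → ℂ} (h : f =ᵐ[μ₄] g) (w : List ℤ) :
    wordEnergy α f w = wordEnergy α g w := by
  have : coefficient f (wordFrequency 4 w) = coefficient g (wordFrequency 4 w) :=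
    integral_congr_ae (h.mono fun x hx => by simp only [hx])
  rw [wordEnergy, this, wordEnergy]

theorem corollary5p4 (L : Finset ℤ) (α : ℤ → ℂ)
    (h_zero_mem : (0 : ℤ) ∈ L)
    (h_odd : ∀ l ∈ L, l ≠ 0 → Odd l)
    (h_cond :
      (∃ l₀ ∈ L, ∃ l₁ ∈ L, l₀ ≡ 1 [ZMOD 4] ∧ l₁ ≡ 3 [ZMOD 4]) ∨
      (∃ l₀ ∈ L, l₀ ≠ 0 ∧ ∀ C : Set ℝ, IsExtremeCycle 4 {0, 2} {0, l₀} C → C = {0}))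
    (h_ne_zero : ∀ l ∈ L, α l ≠ 0)
    (h_one : α 0 = 1)
    (h_sum : ∑ l ∈ L, ‖α l‖ ^ 2 = 2) :
    IsParsevalFrame (fun w : wordSet L =>
      wordWeight α w • exponentialL2 (selfAffineMeasure 4 {0, 2}) (wordFrequency 4 w)) := by
  set e : wordSet L → Lp ℂ 2 μ₄ := fun w =>
    wordWeight α w • exponentialL2 μ₄ (wordFrequency 4 w) with e_def
  have he : ∀ v (s : Finset (wordSet L)), ∑ w ∈ s, ‖inner ℂ (e w) v‖ ^ 2 ≤ ‖v‖ ^ 2 := by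
    intro v s
    simp_rw [e_def, norm_inner_smul_exponentialL2_sq, ← integral_norm_sq_eq_norm_sq]
    exact sum_wordEnergy_le h_zero_mem h_odd h_one h_sum (Lp.memLp v) s
  have htsum : ∀ t, ‖analysisOperator e he (exponentialL2 μ₄ t)‖ ^ 2
      = ∑' w : wordSet L, wordEnergy α (exponential t) w := by
    intro t
    rw [← (hasSum_norm_analysisOperator e he _).tsum_eq]
    refine tsum_congr fun w => ?_
    rw [norm_inner_symm, e_def, norm_inner_smul_exponentialL2_sq]
    exact wordEnergy_congr_ae α (memLp_exponential _ t).coeFn_toLp w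
  refine isParsevalFrame_of_dense e he _ (topologicalClosure_span_exponentialL2 _) ?_
  rintro _ ⟨t, rfl⟩
  -- The energy is the squared norm of a bounded operator along the norm-continuous curve `t ↦ e_t`.
  have hcont : Continuous fun t : ℝ => ∑' w : wordSet L, wordEnergy α (exponential t) w := by
    simp_rw [← htsum]
    exact ((analysisOperator e he).continuous.comp (continuous_exponentialL2 _)).norm.pow 2
  rw [htsum, tsum_wordEnergy_exponential_eq_one h_zero_mem h_odd h_cond h_ne_zero h_one h_sum
    hcont, ← integral_norm_sq_eq_norm_sq, ← integral_norm_exponential_sq t]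
  refine integral_congr_ae ?_
  filter_upwards [(memLp_exponential μ₄ t).coeFn_toLp] with x hx
  rw [exponentialL2, hx]
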